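/- For positive integers $k, m$ with $\gcd(k,m)=1$ let $$\Phi(m)=\{\beta\in\mathbb F_{2^m} : X^{2^k+1}+X+\beta \text{ has no root in } \mathbb F_{2^m}\}$$ and let $$N(m)=\bigl|\{\beta\in\Phi(m) : \beta\notin\mathbb F_{2^{m'}} \text{ for every } m'<m \text{ with } m'\mid m\}\bigr|.$$ Write $m=3^{n_0}\prod_{i=1}^t p_i^{n_i}$, where $n_0\ge 0$ and $t\ge 0$ are integers, $p_1,\dots,p_t$ are distinct primes different from $3$, and $n_1,\dots,n_t$ are positive integers. If $t=0$ (that is, $m=3^{n_0}$, including $m=1$), then $$N(m)=\frac{2^m+1}{3}.$$ If $t\ge 1$, then $$N(m)=\frac13\left(\sum_{\ell=0}^{t}(-1)^\ell\sum_{1\le i_1<\dots<i_\ell\le t}2^{\frac{m}{p_{i_1}\cdots p_{i_\ell}}}-\varepsilon\right),$$ where the term for $\ell=0$ is $2^m$, and $\varepsilon=2$ if $t=1$ and $m\equiv 2\pmod 4$, and $\varepsilon=0$ otherwise. -/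

import Mathlib

open scoped Polynomial

/-- The set `Φ` of admissible elements of a field `F`, for the exponent `k`: the `β ∈ F` such
that the polynomial `X ^ (2 ^ k + 1) + X + β` has no root in `F`. -/
def Phi (k : ℕ) (F : Type*) [Field F] : Set F :=
  {β : F | ∀ x : F,
    ¬ (Polynomial.X ^ (2 ^ k + 1) + Polynomial.X + Polynomial.C β : F[X]).IsRoot x}

/-- The number `N(m)`, for a field `F` with `2 ^ m` elements: the number of admissible `β ∈ F`
that lie in no subfield of `F` with `2 ^ m'` elements, for any `m' < m` dividing `m`. -/
noncomputable def N (k m : ℕ) (F : Type*) [Field F] : ℕ :=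
  Set.ncard {β : F | β ∈ Phi k F ∧
    ∀ m' : ℕ, m' ∣ m → m' < m → ∀ K : Subfield F, Nat.card K = 2 ^ m' → β ∉ K}

/-- The correction term `ε`. -/
def epsilonCorr (t m : ℕ) : ℚ :=
  if t = 1 ∧ m ≡ 2 [MOD 4] then 2 else 0

/-! Write f(x) = x^(2^k+1) + x and q = 2^m. Since the characteristic is 2, Φ(m) is the set of
non-values of f on F_q. Count: f takes 0 twice and every other value once or three times
(`unique_or_three_roots`). The first two moments of the fibre sizes then give 3|Φ(m)| = 2^m + 1,
less 2 when m is even (`three_mul_card_Phi`). Descent: if 3 ∤ d, a non-value over F_q remains one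
over F_{q^d}, because Frobenius permutes at most three roots and a fixed-point-free action must be a
3-cycle (`nonValues_subset_of_not_three_dvd`). Over F_{q^3} every non-value of F_q acquires a root
(`exists_root_of_mem_nonValues`): an explicit family of cross ratios yields enough non-values with
cubic roots to exhaust them all. Hence elements of Φ(m) never lie in a subfield of index 3, and Φ(m)
meets a subfield of index prime to 3 in that subfield's own Φ. Inclusion–exclusion over the primes
p_i (`N_eq_sum`) gives the powers of 2 plus an alternating sum of signs, evaluated in `sum_sign`. -/

theorem pow_two_pow_gcd {M : Type*} [Monoid M] {x : M} {a b : ℕ}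
    (ha : x ^ 2 ^ a = x) (hb : x ^ 2 ^ b = x) : x ^ 2 ^ a.gcd b = x := by
  have key : ∀ n, ((fun y : M => y ^ 2)^[n]) x = x ^ 2 ^ n := fun n => by
    rw [pow_iterate]
  have := Function.IsPeriodicPt.gcd (f := fun y : M => y ^ 2) (x := x) (m := a) (n := b)
    ((key a).trans ha) ((key b).trans hb)
  exact (key _).symm.trans this

theorem pow_two_pow_of_dvd {M : Type*} [Monoid M] {x : M} {a b : ℕ}
    (ha : x ^ 2 ^ a = x) (hab : a ∣ b) : x ^ 2 ^ b = x := by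
  obtain ⟨c, rfl⟩ := hab
  induction c with
  | zero => simp
  | succ c ih => rw [Nat.mul_succ, pow_add, pow_mul, ih, ha]

/-- The map `x ↦ x ^ (2 ^ k + 1) + x`. -/
def trinomial {E : Type*} [Field E] (k : ℕ) (x : E) : E := x ^ (2 ^ k + 1) + x

theorem eq_zero_or_one_of_coprime {E : Type*} [Field E] {k m : ℕ} (hkm : k.Coprime m) {x : E}
    (hm : x ^ 2 ^ m = x) (hk : x ^ 2 ^ k = x) : x = 0 ∨ x = 1 := by
  have h := pow_two_pow_gcd hk hm
  rw [hkm.gcd_eq_one, pow_one] at h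
  have : x * (x - 1) = 0 := by linear_combination h
  rcases mul_eq_zero.1 this with h | h
  · exact Or.inl h
  · exact Or.inr (sub_eq_zero.1 h)

/-- The quotient x / y is fixed by both Frobenius powers, hence lies in F_2. This makes kernels of
binomials a v^(2^k) + b v at most one-dimensional over F_2. -/
theorem eq_of_pow_mul_eq {E : Type*} [Field E] {k m : ℕ} (hkm : k.Coprime m) {x y : E}
    (hx : x ^ 2 ^ m = x) (hy : y ^ 2 ^ m = y) (hx0 : x ≠ 0) (hy0 : y ≠ 0)
    (h : x ^ 2 ^ k * y = y ^ 2 ^ k * x) : x = y := by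
  have h1 : (x / y) ^ 2 ^ m = x / y := by rw [div_pow, hx, hy]
  have h2 : (x / y) ^ 2 ^ k = x / y := by
    rw [div_pow, div_eq_div_iff (pow_ne_zero _ hy0) hy0, h, mul_comm]
  rcases eq_zero_or_one_of_coprime hkm h1 h2 with h | h
  · exact absurd h (div_ne_zero hx0 hy0)
  · exact (div_eq_one_iff_eq hy0).1 h

theorem pow_two_pow_card {E : Type*} [Field E] [Fintype E] {m : ℕ} (hE : Fintype.card E = 2 ^ m) (x : E) : x ^ 2 ^ m = x := by
  rw [← hE, FiniteField.pow_card]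

/-- By coprimality the power map u ↦ u^(2^k-1) has trivial kernel on the finite unit group, so it is
onto. -/
theorem exists_pow_eq_mul {E : Type*} [Field E] [Fintype E] {k m : ℕ} (hkm : k.Coprime m) (hE : Fintype.card E = 2 ^ m) {a : E}
    (ha : a ≠ 0) : ∃ w : E, w ≠ 0 ∧ w ^ 2 ^ k = a * w := by
  have hinj : Function.Injective (powMonoidHom (2 ^ k - 1) : Eˣ →* Eˣ) := by
    rw [injective_iff_map_eq_one]
    intro u hu
    have hu' : (u : E) ^ (2 ^ k - 1) = 1 := by
      have := congrArg Units.val hu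
      simpa using this
    have h2 : (u : E) ^ 2 ^ k = u := by
      rw [← Nat.sub_add_cancel (Nat.one_le_two_pow (n := k)), pow_succ, hu', one_mul]
    rcases eq_zero_or_one_of_coprime hkm (pow_two_pow_card hE _) h2 with h | h
    · exact absurd h u.ne_zero
    · exact Units.ext h
  obtain ⟨w, hw⟩ := Finite.injective_iff_surjective.1 hinj (Units.mk0 a ha)
  refine ⟨w, w.ne_zero, ?_⟩
  have hw' : (w : E) ^ (2 ^ k - 1) = a := by
    have := congrArg Units.val hw
    simpa using this
  rw [← Nat.sub_add_cancel (Nat.one_le_two_pow (n := k)), pow_succ, hw']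

/-! ### The trinomial map in characteristic 2 -/

section CharTwo

variable {E : Type*} [Field E] [CharP E 2]

theorem add_eq_iff_eq_add (a b c : E) : a + b = c ↔ a = c + b := by
  rw [← sub_eq_iff_eq_add, CharTwo.sub_eq_add]

theorem mem_Phi_iff (k : ℕ) (b : E) : b ∈ Phi k E ↔ ∀ x : E, trinomial k x ≠ b := by
  simp only [Phi, trinomial, Set.mem_ofPred_eq, Polynomial.IsRoot.def, Polynomial.eval_add,
    Polynomial.eval_pow, Polynomial.eval_X, Polynomial.eval_C, CharTwo.add_eq_zero, ne_eq]

theorem trinomial_eq_zero {k : ℕ} {x : E} :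
    trinomial k x = 0 ↔ x = 0 ∨ x = 1 := by
  constructor
  · intro h
    rw [trinomial, pow_succ] at h
    have : x * ((x + 1) ^ 2 ^ k) = 0 := by
      rw [add_pow_char_pow, one_pow]; linear_combination h
    rcases mul_eq_zero.1 this with h | h
    · exact Or.inl h
    · exact Or.inr (CharTwo.add_eq_zero.1 (eq_zero_of_pow_eq_zero h))
  · rintro (rfl | rfl) <;> simp [trinomial, CharTwo.add_self_eq_zero]

/-- Writing another root as x + 1/w linearises the problem: the condition on w is affine over F_2.
-/
theorem trinomial_add_inv (k : ℕ) {x w : E} (hw : w ≠ 0) :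
    trinomial k (x + w⁻¹) = trinomial k x ↔ (x ^ 2 ^ k + 1) * w ^ 2 ^ k + x * w = 1 := by
  have hw' : w ^ 2 ^ k ≠ 0 := pow_ne_zero _ hw
  have key : trinomial k (x + w⁻¹) - trinomial k x
      = ((x ^ 2 ^ k + 1) * w ^ 2 ^ k + x * w + 1) * (w⁻¹ * (w ^ 2 ^ k)⁻¹) := by
    rw [trinomial, trinomial, pow_succ, pow_succ, add_pow_char_pow, inv_pow]
    field_simp
    ring
  rw [← sub_eq_zero, key, mul_eq_zero, or_iff_left (mul_ne_zero (inv_ne_zero hw)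
    (inv_ne_zero hw')), CharTwo.add_eq_zero]

end CharTwo

/-! ### Fibre sizes over a finite field -/

section Finite

variable {E : Type*} [Field E] [CharP E 2] [Fintype E] {k m : ℕ}

/-- A nonzero value of the trinomial map has one or three preimages. -/
theorem unique_or_three_roots (hkm : k.Coprime m) (hE : Fintype.card E = 2 ^ m) {x : E}
    (hx : trinomial k x ≠ 0) :
    (∀ t, trinomial k t = trinomial k x → t = x) ∨
    ∃ y z, x ≠ y ∧ x ≠ z ∧ y ≠ z ∧ trinomial k y = trinomial k x ∧
      trinomial k z = trinomial k x ∧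
      ∀ t, trinomial k t = trinomial k x → t = x ∨ t = y ∨ t = z := by
  have hx' := hx
  rw [Ne, trinomial_eq_zero, not_or] at hx'
  obtain ⟨hx0, hx1⟩ := hx'
  have hx1' : x ^ 2 ^ k + 1 ≠ 0 := by
    have : (x + 1) ^ 2 ^ k ≠ 0 := pow_ne_zero _ (fun h => hx1 (CharTwo.add_eq_zero.1 h))
    rwa [add_pow_char_pow, one_pow] at this
  -- κ is the nonzero element of the kernel of the homogeneous equation, so the affine one has no
  -- solution or exactly w and w + κ.
  obtain ⟨κ, hκ0, hκ⟩ := exists_pow_eq_mul hkm hE (div_ne_zero hx0 hx1')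
  have hκ' : (x ^ 2 ^ k + 1) * κ ^ 2 ^ k = x * κ := by rw [hκ]; field_simp
  have hker : ∀ v : E, (x ^ 2 ^ k + 1) * v ^ 2 ^ k = x * v → v = 0 ∨ v = κ := by
    intro v hv
    by_cases hv0 : v = 0
    · exact Or.inl hv0
    refine Or.inr (eq_of_pow_mul_eq hkm (pow_two_pow_card hE _) (pow_two_pow_card hE _) hv0 hκ0
      (mul_left_cancel₀ hx1' ?_))
    linear_combination κ * hv - v * hκ'
  by_cases hw : ∃ w : E, w ≠ 0 ∧ (x ^ 2 ^ k + 1) * w ^ 2 ^ k + x * w = 1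
  · obtain ⟨w, hw0, hw⟩ := hw
    have hwκ : (x ^ 2 ^ k + 1) * (w + κ) ^ 2 ^ k + x * (w + κ) = 1 := by
      rw [add_pow_char_pow]
      linear_combination hw + hκ' + CharTwo.add_self_eq_zero (x * κ)
    have hwκ0 : w + κ ≠ 0 := by
      intro h
      rw [h] at hwκ
      simp at hwκ
    refine Or.inr ⟨x + w⁻¹, x + (w + κ)⁻¹, ?_, ?_, ?_, (trinomial_add_inv k hw0).2 hw,
      (trinomial_add_inv k hwκ0).2 hwκ, ?_⟩
    · simpa using hw0
    · simpa using hwκ0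
    · simpa using hκ0
    · intro t ht
      by_cases htx : t = x
      · exact Or.inl htx
      have hv0 : (t + x)⁻¹ ≠ 0 := inv_ne_zero (fun h => htx (CharTwo.add_eq_zero.1 h))
      have htv : t = x + ((t + x)⁻¹)⁻¹ := by
        rw [inv_inv]; linear_combination -CharTwo.add_self_eq_zero x
      generalize (t + x)⁻¹ = v at hv0 htv
      subst htv
      rw [trinomial_add_inv k hv0] at ht
      have := hker (v + w) (by
        rw [add_pow_char_pow]
        linear_combination ht + hw - CharTwo.add_self_eq_zero (x * v)
          - CharTwo.add_self_eq_zero (x * w) + CharTwo.add_self_eq_zero (1 : E))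
      rcases this with h | h
      · rw [CharTwo.add_eq_zero.1 h]; simp
      · rw [add_eq_iff_eq_add] at h
        rw [h, add_comm κ]; simp
  · left
    intro t ht
    by_contra htx
    have hv0 : (t + x)⁻¹ ≠ 0 := inv_ne_zero (fun h => htx (CharTwo.add_eq_zero.1 h))
    refine hw ⟨(t + x)⁻¹, hv0, (trinomial_add_inv k hv0).1 ?_⟩
    rw [inv_inv, ← ht]
    congr 1
    linear_combination CharTwo.add_self_eq_zero x

/-- Applying u ↦ u^(2^k) = u + 1 twice fixes u. As 2k is prime to m, u lies in F_2, where the left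
side is 0. -/
theorem card_pow_add_self_eq_one_of_odd (hkm : k.Coprime m) (hE : Fintype.card E = 2 ^ m)
    (hm : Odd m) (u : E) : u ^ 2 ^ k + u ≠ 1 := by
  intro h
  have h1 : u ^ 2 ^ k = 1 + u := (add_eq_iff_eq_add _ _ _).1 h
  have h2 : u ^ 2 ^ (k * 2) = u := by
    rw [pow_mul, sq, pow_mul, h1, add_pow_char_pow, one_pow, h1]
    linear_combination CharTwo.add_self_eq_zero (1 : E)
  have h3 : (k * 2).Coprime m := Nat.Coprime.mul_left hkm (Nat.coprime_two_left.2 hm)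
  rcases eq_zero_or_one_of_coprime h3 (pow_two_pow_card hE u) h2 with rfl | rfl
  · simp at h
  · simp [CharTwo.add_self_eq_zero] at h

theorem exists_sq_add_self_eq_one (hE : Fintype.card E = 2 ^ m) (hm0 : 0 < m) (hm : Even m) :
    ∃ u : E, u ^ 2 + u = 1 := by
  classical
  obtain ⟨j, rfl⟩ := hm
  have h3 : 3 ∣ Fintype.card Eˣ := by
    rw [Fintype.card_units, hE, ← two_mul, pow_mul]
    simpa using Nat.sub_dvd_pow_sub_pow 4 1 j
  have : Fact (Nat.Prime 3) := ⟨Nat.prime_three⟩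
  obtain ⟨u, hu⟩ := exists_prime_orderOf_dvd_card 3 h3
  have hu1 : (u : E) ^ 3 = 1 := by
    have := congrArg Units.val (pow_orderOf_eq_one u)
    rwa [hu, Units.val_pow_eq_pow_val, Units.val_one] at this
  have hu2 : (u : E) - 1 ≠ 0 := by
    intro h
    have : u = 1 := Units.ext (sub_eq_zero.1 h)
    rw [this, orderOf_one] at hu
    omega
  refine ⟨u, mul_left_cancel₀ hu2 ?_⟩
  linear_combination hu1 - CharTwo.add_self_eq_zero ((u:E) - 1)

theorem card_pow_add_self_eq_one_of_even [DecidableEq E] (hkm : k.Coprime m)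
    (hE : Fintype.card E = 2 ^ m) (hm0 : 0 < m) (hm : Even m) :
    (Finset.univ.filter fun u : E => u ^ 2 ^ k + u = 1).card = 2 := by
  obtain ⟨u, hu⟩ := exists_sq_add_self_eq_one hE hm0 hm
  have hk : Odd k := by
    rw [← Nat.coprime_two_left]
    exact (hkm.coprime_dvd_right hm.two_dvd).symm
  -- u lies in F_4 and k is odd, so the 2^k-th power acts on u as squaring.
  have huk : u ^ 2 ^ k + u = 1 := by
    obtain ⟨j, rfl⟩ := hk
    have h4 : u ^ 2 ^ 2 = u := by
      have : u ^ 2 = 1 + u := (add_eq_iff_eq_add _ _ _).1 hu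
      have e : u ^ 2 ^ 2 = (u ^ 2) ^ 2 := by ring
      rw [e, this]
      linear_combination hu + CharTwo.add_self_eq_zero (1 : E)
    rw [pow_succ, pow_mul, pow_two_pow_of_dvd h4 (dvd_mul_right 2 j), hu]
  have : (Finset.univ.filter fun u : E => u ^ 2 ^ k + u = 1) = {u, u + 1} := by
    ext v
    simp only [Finset.mem_filter, Finset.mem_univ, true_and, Finset.mem_insert,
      Finset.mem_singleton]
    constructor
    · intro hv
      have h1 : (v + u) ^ 2 ^ k = v + u := by
        rw [add_pow_char_pow]
        linear_combination hv + huk - CharTwo.add_self_eq_zero (v + u)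
          + CharTwo.add_self_eq_zero (1 : E)
      rcases eq_zero_or_one_of_coprime hkm (pow_two_pow_card hE _) h1 with h | h
      · exact Or.inl (CharTwo.add_eq_zero.1 h)
      · rw [add_eq_iff_eq_add] at h
        exact Or.inr (h.trans (add_comm _ _))
    · rintro (rfl | rfl)
      · exact huk
      · rw [add_pow_char_pow, one_pow]
        linear_combination huk + CharTwo.add_self_eq_zero (1:E)
  rw [this, Finset.card_pair]
  simp

end Finite

/-! ### Counting non-values by second moments -/

section Counting

variable {E : Type*} [Field E] [CharP E 2]

theorem pow_two_pow_injective (k : ℕ) : Function.Injective fun x : E => x ^ 2 ^ k := by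
  intro x y h
  have h' : (x + y) ^ 2 ^ k = 0 := by
    rw [add_pow_char_pow]; exact CharTwo.add_eq_zero.2 h
  exact CharTwo.add_eq_zero.1 (eq_zero_of_pow_eq_zero h')

theorem trinomial_eq_trinomial_iff {k : ℕ} {x y : E} (hxy : x ≠ y) :
    trinomial k x = trinomial k y ↔
      (x + y)⁻¹ ^ 2 ^ k = (x / (x + y)) ^ 2 ^ k + x / (x + y) + 1 := by
  have hw : (x + y)⁻¹ ≠ 0 := inv_ne_zero fun h => hxy (CharTwo.add_eq_zero.1 h)
  have hy : y = x + ((x + y)⁻¹)⁻¹ := by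
    rw [inv_inv]; linear_combination -CharTwo.add_self_eq_zero x
  rw [div_eq_mul_inv]
  generalize (x + y)⁻¹ = w at *
  rw [eq_comm, hy, trinomial_add_inv k hw, mul_pow, ← CharTwo.add_eq_zero,
    ← CharTwo.add_eq_zero (a := w ^ 2 ^ k)]
  constructor <;> intro h <;> linear_combination h

variable [Fintype E] [DecidableEq E] {k m : ℕ}

/-- With u = x/(x+y) and w = 1/(x+y), the collision condition reads w^(2^k) = u^(2^k) + u + 1. So u
determines w, hence (x, y), and w ≠ 0 is the only restriction. -/
theorem card_offDiag_trinomial (k : ℕ) :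
    (Finset.univ.filter fun p : E × E => p.1 ≠ p.2 ∧ trinomial k p.1 = trinomial k p.2).card
      = (Finset.univ.filter fun u : E => u ^ 2 ^ k + u ≠ 1).card := by
  refine Finset.card_bij (fun p _ => p.1 / (p.1 + p.2)) ?_ ?_ ?_
  · rintro ⟨x, y⟩ h
    simp only [Finset.mem_filter, Finset.mem_univ, true_and] at h ⊢
    intro hu
    have := (trinomial_eq_trinomial_iff h.1).1 h.2
    rw [hu, CharTwo.add_self_eq_zero] at this
    exact h.1 (CharTwo.add_eq_zero.1 (inv_eq_zero.1 (eq_zero_of_pow_eq_zero this)))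
  · rintro ⟨x, y⟩ h ⟨x', y'⟩ h' e
    simp only [Finset.mem_filter, Finset.mem_univ, true_and] at h h' e
    have h1 := (trinomial_eq_trinomial_iff h.1).1 h.2
    have h2 := (trinomial_eq_trinomial_iff h'.1).1 h'.2
    rw [e, ← h2] at h1
    have hw : x + y = x' + y' := inv_injective (pow_two_pow_injective k h1)
    have hw0 : x' + y' ≠ 0 := fun h => h'.1 (CharTwo.add_eq_zero.1 h)
    rw [hw] at e
    have hx : x = x' := (div_left_inj' hw0).1 e
    subst hx
    rw [add_right_inj] at hw
    rw [hw]
  · intro u hu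
    simp only [Finset.mem_filter, Finset.mem_univ, true_and] at hu
    obtain ⟨w, hw⟩ := Finite.injective_iff_surjective.1 (pow_two_pow_injective (E := E) k)
      (u ^ 2 ^ k + u + 1)
    have hw0 : w ≠ 0 := by
      rintro rfl
      simp only [ne_eq, pow_eq_zero_iff', OfNat.ofNat_ne_zero, false_and, not_false_eq_true,
        zero_pow] at hw
      exact hu (CharTwo.add_eq_zero.1 hw.symm)
    have e1 : u / w + (u / w + w⁻¹) = w⁻¹ := by
      linear_combination CharTwo.add_self_eq_zero (u / w)
    have e2 : u / w / (u / w + (u / w + w⁻¹)) = u := by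
      rw [e1]; field_simp
    have hne : u / w ≠ u / w + w⁻¹ := by simpa using hw0
    refine ⟨(u / w, u / w + w⁻¹), ?_, e2⟩
    simp only [Finset.mem_filter, Finset.mem_univ, true_and]
    refine ⟨hne, (trinomial_eq_trinomial_iff hne).2 ?_⟩
    rw [e2, e1, inv_inv]
    exact hw

/-- For fibre size s, (s-1)(s-3) is 3 at s = 0, vanishes at 1 and 3, and is -1 at s = 2, which
occurs only for b = 0. The terms are arranged to avoid subtraction. -/
theorem card_fiber_identity (hkm : k.Coprime m) (hE : Fintype.card E = 2 ^ m) (b : E) :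
    3 * (if ∀ x : E, trinomial k x ≠ b then 1 else 0)
        + 4 * (Finset.univ.filter fun x : E => trinomial k x = b).card
      = 3 + (Finset.univ.filter fun x : E => trinomial k x = b).card ^ 2
        + if b = 0 then 1 else 0 := by
  by_cases hb : b = 0
  · subst hb
    have : (Finset.univ.filter fun x : E => trinomial k x = 0) = {0, 1} := by
      ext; simp [trinomial_eq_zero]
    have h0 : ¬ ∀ x : E, trinomial k x ≠ 0 := fun h => h 0 (trinomial_eq_zero.2 (Or.inl rfl))
    rw [this, if_neg h0, Finset.card_pair zero_ne_one]
    simp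
  rw [if_neg hb]
  by_cases h0 : ∀ x : E, trinomial k x ≠ b
  · rw [if_pos h0, Finset.filter_false_of_mem fun x _ => h0 x]
    simp
  rw [if_neg h0]
  push Not at h0
  obtain ⟨x, rfl⟩ := h0
  rcases unique_or_three_roots hkm hE hb with h | ⟨y, z, hxy, hxz, hyz, hy, hz, h⟩
  · have : (Finset.univ.filter fun t : E => trinomial k t = trinomial k x) = {x} := by
      ext t
      simp only [Finset.mem_filter, Finset.mem_univ, true_and, Finset.mem_singleton]
      exact ⟨h t, by rintro rfl; rfl⟩
    rw [this]; simp
  · have : (Finset.univ.filter fun t : E => trinomial k t = trinomial k x) = {x, y, z} := by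
      ext t
      simp only [Finset.mem_filter, Finset.mem_univ, true_and, Finset.mem_insert,
        Finset.mem_singleton]
      refine ⟨h t, ?_⟩
      rintro (rfl | rfl | rfl)
      exacts [rfl, hy, hz]
    rw [this, Finset.card_eq_three.2 ⟨x, y, z, hxy, hxz, hyz, rfl⟩]
    rfl

theorem three_mul_card_Phi (hkm : k.Coprime m) (hm0 : 0 < m) (hE : Fintype.card E = 2 ^ m) :
    3 * (Phi k E).ncard + (if Even m then 2 else 0) = 2 ^ m + 1 := by
  have hsum := Finset.sum_congr (rfl : (Finset.univ : Finset E) = Finset.univ)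
    fun b _ => card_fiber_identity (k := k) hkm hE b
  have hPhi : (Phi k E).ncard
      = ∑ b : E, if ∀ x : E, trinomial k x ≠ b then 1 else 0 := by
    rw [← Finset.card_filter, ← Set.ncard_coe_finset]
    congr 1
    ext b
    simp [mem_Phi_iff]
  have h1 : ∑ b : E, (Finset.univ.filter fun x : E => trinomial k x = b).card = 2 ^ m := by
    rw [← hE, ← Finset.card_univ]
    exact (Finset.card_eq_sum_card_fiberwise fun x _ => Finset.mem_univ (trinomial k x)).symm
  have h2 : ∑ b : E, (Finset.univ.filter fun x : E => trinomial k x = b).card ^ 2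
      = (Finset.univ.filter fun p : E × E => trinomial k p.1 = trinomial k p.2).card := by
    rw [Finset.card_eq_sum_card_fiberwise (t := Finset.univ) (f := fun p => trinomial k p.1)
      fun x _ => Finset.mem_univ _]
    refine Finset.sum_congr rfl fun b _ => ?_
    rw [sq, ← Finset.card_product]
    congr 1
    ext ⟨x, y⟩
    simp only [Finset.mem_product, Finset.mem_filter, Finset.mem_univ, true_and]
    constructor
    · rintro ⟨rfl, h⟩; exact ⟨h.symm, rfl⟩
    · rintro ⟨h, rfl⟩; exact ⟨rfl, h.symm⟩
  have h3 : (Finset.univ.filter fun p : E × E => trinomial k p.1 = trinomial k p.2).card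
      = 2 ^ m + (Finset.univ.filter fun u : E => u ^ 2 ^ k + u ≠ 1).card := by
    rw [← card_offDiag_trinomial, ← Finset.card_filter_add_card_filter_not
      (fun p : E × E => p.1 = p.2), Finset.filter_filter, Finset.filter_filter]
    congr 1
    · rw [← hE, ← Finset.card_univ]
      symm
      refine Finset.card_bij (fun x _ => (x, x)) (by simp) (by simp) ?_
      rintro ⟨x, y⟩ h
      simp only [Finset.mem_filter, Finset.mem_univ, true_and] at h
      exact ⟨x, Finset.mem_univ _, by rw [h.2]⟩
    · simp only [and_comm, ne_eq]
  have h4 : (Finset.univ.filter fun u : E => u ^ 2 ^ k + u ≠ 1).card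
      + (if Even m then 2 else 0) = 2 ^ m := by
    have hsplit := Finset.card_filter_add_card_filter_not (s := (Finset.univ : Finset E))
      (fun u : E => u ^ 2 ^ k + u = 1)
    rw [Finset.card_univ, hE] at hsplit
    simp only [ne_eq]
    split_ifs with hm
    · rw [card_pow_add_self_eq_one_of_even hkm hE hm0 hm] at hsplit
      omega
    · rw [Finset.filter_false_of_mem fun u _ =>
        card_pow_add_self_eq_one_of_odd hkm hE (Nat.not_even_iff_odd.1 hm) u] at hsplit
      simpa only [Finset.card_empty, zero_add, add_zero] using hsplit
  simp only [Finset.sum_add_distrib, ← Finset.mul_sum] at hsum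
  rw [← hPhi, h1, h2, h3] at hsum
  simp only [Finset.sum_const, Finset.card_univ, hE, smul_eq_mul, Finset.sum_ite_eq',
    Finset.mem_univ, if_true] at hsum
  omega

end Counting

/-! ### Finite fields inside an algebraically closed field; extensions of degree prime to 3 -/

section AlgClosed

variable {Ω : Type*} [Field Ω] [CharP Ω 2]

/-- The subfield of elements fixed by `x ↦ x ^ 2 ^ m`. -/
def fixedPow (Ω : Type*) [Field Ω] [CharP Ω 2] (m : ℕ) : Subfield Ω :=
  (iterateFrobenius Ω 2 m).eqLocusField (RingHom.id Ω)

theorem mem_fixedPow {m : ℕ} {x : Ω} : x ∈ fixedPow Ω m ↔ x ^ 2 ^ m = x := by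
  rw [fixedPow, RingHom.mem_eqLocusField, iterateFrobenius_def, RingHom.id_apply]

/-- The elements of the field with `2 ^ m` elements inside `Ω` that are not values of the
trinomial map on that field. -/
def nonValues (Ω : Type*) [Field Ω] [CharP Ω 2] (k m : ℕ) : Set Ω :=
  {b | b ∈ fixedPow Ω m ∧ ∀ x ∈ fixedPow Ω m, trinomial k x ≠ b}

theorem fixedPow_le {a b : ℕ} (h : a ∣ b) : fixedPow Ω a ≤ fixedPow Ω b := fun _ hx =>
  mem_fixedPow.2 (pow_two_pow_of_dvd (mem_fixedPow.1 hx) h)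

theorem mem_fixedPow_gcd {a b : ℕ} {x : Ω} :
    x ∈ fixedPow Ω (a.gcd b) ↔ x ∈ fixedPow Ω a ∧ x ∈ fixedPow Ω b :=
  ⟨fun h => ⟨fixedPow_le (Nat.gcd_dvd_left a b) h, fixedPow_le (Nat.gcd_dvd_right a b) h⟩,
    fun h => mem_fixedPow.2 (pow_two_pow_gcd (mem_fixedPow.1 h.1) (mem_fixedPow.1 h.2))⟩

theorem card_fixedPow [IsAlgClosed Ω] {m : ℕ} (hm : 0 < m) :
    Nat.card (fixedPow Ω m) = 2 ^ m := by
  classical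
  have hsep : (Polynomial.X ^ 2 ^ m - Polynomial.X : Polynomial Ω).Separable :=
    galois_poly_separable 2 (2 ^ m) (dvd_pow_self 2 hm.ne')
  have h1 : 1 < 2 ^ m := Nat.one_lt_two_pow hm.ne'
  have hcard := Polynomial.card_rootSet_eq_natDegree (K := Ω) hsep (IsAlgClosed.splits _)
  rw [FiniteField.X_pow_card_sub_X_natDegree_eq Ω h1, ← Nat.card_eq_fintype_card] at hcard
  rw [← hcard]
  refine Nat.card_congr (Equiv.subtypeEquivRight fun x => ?_)
  rw [Polynomial.mem_rootSet, mem_fixedPow]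
  simp [FiniteField.X_pow_card_sub_X_ne_zero Ω h1, sub_eq_zero]

theorem finite_fixedPow [IsAlgClosed Ω] {m : ℕ} (hm : 0 < m) : Finite (fixedPow Ω m) :=
  Nat.finite_of_card_ne_zero (by rw [card_fixedPow hm]; positivity)

theorem mem_fixedPow_iff_exists [IsAlgClosed Ω] {F : Type*} [Field F] {m : ℕ} (hm : 0 < m)
    (hF : Nat.card F = 2 ^ m) (ι : F →+* Ω) {y : Ω} :
    y ∈ fixedPow Ω m ↔ ∃ x, ι x = y := by
  have hfin : Finite F := Nat.finite_of_card_ne_zero (by rw [hF]; positivity)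
  have := Fintype.ofFinite F
  have hsub : Set.range ι ⊆ (fixedPow Ω m : Set Ω) := by
    rintro _ ⟨x, rfl⟩
    rw [SetLike.mem_coe, mem_fixedPow, ← map_pow,
      pow_two_pow_card (by rw [← Nat.card_eq_fintype_card, hF])]
  have hfin' : Finite ((fixedPow Ω m : Set Ω)) := finite_fixedPow hm
  have heq := Set.eq_of_subset_of_ncard_le hsub (by
    rw [← Nat.card_coe_set_eq, ← Nat.card_coe_set_eq, Nat.card_range_of_injective ι.injective,
      hF]
    exact (card_fixedPow hm).le) (Set.toFinite _)
  rw [← SetLike.mem_coe, ← heq]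
  rfl

theorem map_trinomial {F Ω : Type*} [Field F] [Field Ω] (ι : F →+* Ω) (k : ℕ) (x : F) :
    ι (trinomial k x) = trinomial k (ι x) := by
  simp [trinomial]

theorem trinomial_pow (k n : ℕ) (x : Ω) : trinomial k (x ^ 2 ^ n) = trinomial k x ^ 2 ^ n := by
  rw [trinomial, trinomial, add_pow_char_pow, ← pow_mul, ← pow_mul, mul_comm]

theorem mem_nonValues_iff [IsAlgClosed Ω] {F : Type*} [Field F] [CharP F 2] {k m : ℕ}
    (hm : 0 < m) (hF : Nat.card F = 2 ^ m) (ι : F →+* Ω) {b : F} :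
    ι b ∈ nonValues Ω k m ↔ b ∈ Phi k F := by
  rw [mem_Phi_iff]
  constructor
  · rintro ⟨-, h⟩ x hx
    exact h (ι x) ((mem_fixedPow_iff_exists hm hF ι).2 ⟨x, rfl⟩) (by rw [← map_trinomial, hx])
  · intro h
    refine ⟨(mem_fixedPow_iff_exists hm hF ι).2 ⟨b, rfl⟩, fun y hy hyb => ?_⟩
    obtain ⟨x, rfl⟩ := (mem_fixedPow_iff_exists hm hF ι).1 hy
    rw [← map_trinomial] at hyb
    exact h x (ι.injective hyb)

theorem nonValues_eq_image [IsAlgClosed Ω] {F : Type*} [Field F] [CharP F 2] {k m : ℕ}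
    (hm : 0 < m) (hF : Nat.card F = 2 ^ m) (ι : F →+* Ω) :
    nonValues Ω k m = ι '' Phi k F := by
  ext y
  constructor
  · intro hy
    obtain ⟨x, rfl⟩ := (mem_fixedPow_iff_exists hm hF ι).1 hy.1
    exact ⟨x, (mem_nonValues_iff hm hF ι).1 hy, rfl⟩
  · rintro ⟨x, hx, rfl⟩
    exact (mem_nonValues_iff hm hF ι).2 hx

variable [IsAlgClosed Ω] {k m : ℕ}

theorem three_mul_card_nonValues (hkm : k.Coprime m) (hm : 0 < m) :
    3 * (nonValues Ω k m).ncard + (if Even m then 2 else 0) = 2 ^ m + 1 := by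
  classical
  have := finite_fixedPow (Ω := Ω) hm
  have := Fintype.ofFinite (fixedPow Ω m)
  rw [nonValues_eq_image hm (card_fixedPow hm) (fixedPow Ω m).subtype,
    Set.ncard_image_of_injective _ (fixedPow Ω m).subtype.injective]
  exact three_mul_card_Phi hkm hm (by rw [← Nat.card_eq_fintype_card, card_fixedPow hm])

theorem unique_or_three_roots_fixedPow (hkm : k.Coprime m) (hm : 0 < m) {x : Ω}
    (hxm : x ∈ fixedPow Ω m) (hx : trinomial k x ≠ 0) :
    (∀ t ∈ fixedPow Ω m, trinomial k t = trinomial k x → t = x) ∨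
    ∃ y ∈ fixedPow Ω m, ∃ z ∈ fixedPow Ω m, x ≠ y ∧ x ≠ z ∧ y ≠ z ∧
      trinomial k y = trinomial k x ∧ trinomial k z = trinomial k x ∧
      ∀ t ∈ fixedPow Ω m, trinomial k t = trinomial k x → t = x ∨ t = y ∨ t = z := by
  have := finite_fixedPow (Ω := Ω) hm
  have := Fintype.ofFinite (fixedPow Ω m)
  have hE : Fintype.card (fixedPow Ω m) = 2 ^ m := by
    rw [← Nat.card_eq_fintype_card, card_fixedPow hm]
  have hι := map_trinomial (fixedPow Ω m).subtype k
  simp only [Subfield.subtype_apply] at hι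
  have h0 : trinomial k (⟨x, hxm⟩ : fixedPow Ω m) ≠ 0 := fun h => hx (by
    have := hι ⟨x, hxm⟩
    rw [h] at this
    exact this.symm)
  have hl : ∀ t (ht : t ∈ fixedPow Ω m), trinomial k t = trinomial k x →
      trinomial k (⟨t, ht⟩ : fixedPow Ω m) = trinomial k ⟨x, hxm⟩ := fun t ht h =>
    Subtype.ext (by rw [hι, hι]; exact h)
  rcases unique_or_three_roots hkm hE h0 with h | ⟨y, z, hxy, hxz, hyz, hy, hz, h⟩
  · exact Or.inl fun t ht e => congrArg Subtype.val (h ⟨t, ht⟩ (hl t ht e))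
  · refine Or.inr ⟨y, y.2, z, z.2, fun e => hxy (Subtype.ext e), fun e => hxz (Subtype.ext e),
      fun e => hyz (Subtype.ext e), by rw [← hι, hy, hι], by rw [← hι, hz, hι], fun t ht e => ?_⟩
    rcases h ⟨t, ht⟩ (hl t ht e) with h | h | h
    · exact Or.inl (congrArg Subtype.val h)
    · exact Or.inr (Or.inl (congrArg Subtype.val h))
    · exact Or.inr (Or.inr (congrArg Subtype.val h))

/-- Any three distinct preimages exhaust the preimages of a nonzero value. -/
theorem eq_of_three_roots (hkm : k.Coprime m) (hm : 0 < m) {x y z t b : Ω} (hb : b ≠ 0)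
    (hxm : x ∈ fixedPow Ω m) (hym : y ∈ fixedPow Ω m) (hzm : z ∈ fixedPow Ω m)
    (htm : t ∈ fixedPow Ω m) (hx : trinomial k x = b) (hy : trinomial k y = b)
    (hz : trinomial k z = b) (ht : trinomial k t = b)
    (hxy : x ≠ y) (hxz : x ≠ z) (hyz : y ≠ z) : t = x ∨ t = y ∨ t = z := by
  rcases unique_or_three_roots_fixedPow hkm hm hxm (by rwa [hx]) with h | ⟨u, -, v, -, -, -, -, -, -, h⟩
  · exact absurd (h y hym (hy.trans hx.symm)).symm hxy
  · have h1 := h y hym (hy.trans hx.symm)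
    have h2 := h z hzm (hz.trans hx.symm)
    have h3 := h t htm (ht.trans hx.symm)
    grind

theorem nonValues_subset_of_not_three_dvd {d : ℕ} (hkm : k.Coprime (m * d)) (hm : 0 < m * d)
    (hd : ¬ 3 ∣ d) : nonValues Ω k m ⊆ nonValues Ω k (m * d) := by
  rintro b ⟨hb, hroot⟩
  refine ⟨fixedPow_le (dvd_mul_right m d) hb, fun x hx hxb => ?_⟩
  have hb0 : trinomial k x ≠ 0 := by
    rw [hxb]
    rintro rfl
    exact hroot 0 (zero_mem _) (trinomial_eq_zero.2 (Or.inl rfl))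
  have hinj := pow_two_pow_injective (E := Ω) m
  have hpow : ∀ t ∈ fixedPow Ω (m * d), trinomial k t = b →
      t ^ 2 ^ m ∈ fixedPow Ω (m * d) ∧ trinomial k (t ^ 2 ^ m) = b ∧ t ^ 2 ^ m ≠ t :=
    fun t ht htb => ⟨pow_mem ht _, by rw [trinomial_pow, htb, mem_fixedPow.1 hb],
      fun h => hroot t (mem_fixedPow.2 h) htb⟩
  obtain ⟨hy, hyb, hyx⟩ := hpow x hx hxb
  obtain ⟨hz, hzb, hzy⟩ := hpow _ hy hyb
  obtain ⟨hw, hwb, hwz⟩ := hpow _ hz hzb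
  -- A 3-cycle would put x in F_{q^3} ∩ F_{q^d} = F_q.
  have hcube : ((x ^ 2 ^ m) ^ 2 ^ m) ^ 2 ^ m ≠ x := by
    intro h
    have h3 : x ∈ fixedPow Ω (m * 3) := mem_fixedPow.2 (by
      rw [← pow_mul, ← pow_mul, ← pow_add, ← pow_add] at h
      convert h using 2
      ring)
    have hgcd : (m * 3).gcd (m * d) = m := by
      rw [Nat.gcd_mul_left, ((Nat.prime_three.coprime_iff_not_dvd).2 hd).gcd_eq_one, mul_one]
    have := mem_fixedPow_gcd.2 ⟨h3, hx⟩
    rw [hgcd] at this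
    exact hroot x this hxb
  rcases unique_or_three_roots_fixedPow hkm hm hx hb0 with h | ⟨u, hu, v, hv, hxu, hxv, huv, hub, hvb, h⟩
  · exact hyx (h _ hy (hyb.trans hxb.symm))
  have h1 := h _ hy (hyb.trans hxb.symm)
  have h2 := h _ hz (hzb.trans hxb.symm)
  have h3 := h _ hw (hwb.trans hxb.symm)
  -- A 2-cycle would force Frobenius to fix the third root; otherwise x and its first three
  -- conjugates are four distinct roots.
  by_cases hzx : (x ^ 2 ^ m) ^ 2 ^ m = x
  · obtain ⟨w, hw, hwb, hwx, hwy⟩ : ∃ w ∈ fixedPow Ω (m * d), trinomial k w = b ∧ w ≠ x ∧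
        w ≠ x ^ 2 ^ m := by
      rcases h1 with h1 | h1 | h1
      · exact absurd h1 hyx
      · exact ⟨v, hv, hvb.trans hxb, hxv.symm, fun h => huv (h1.symm.trans h.symm)⟩
      · exact ⟨u, hu, hub.trans hxb, hxu.symm, fun h => huv (h.trans h1)⟩
    obtain ⟨hwm, hwb', hww⟩ := hpow w hw hwb
    have h5 : w ^ 2 ^ m ≠ x := fun h => hwy (hinj (h.trans hzx.symm))
    have h6 : w ^ 2 ^ m ≠ x ^ 2 ^ m := fun h => hwx (hinj h)
    have h7 := h _ hw (hwb.trans hxb.symm)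
    have h8 := h _ hwm (hwb'.trans hxb.symm)
    grind
  · have hwy : ((x ^ 2 ^ m) ^ 2 ^ m) ^ 2 ^ m ≠ x ^ 2 ^ m := fun h => hzx (hinj h)
    grind

end AlgClosed

/-! ### A twisted family of points in the cubic extension -/

section Cubic

variable {Ω : Type*} [Field Ω] [CharP Ω 2] {k m : ℕ}

/-- The solutions of `g ^ 2 ^ m = 1 / (g + 1)`. -/
def twistedSet (Ω : Type*) [Field Ω] (m : ℕ) : Set Ω := {g | g ^ 2 ^ m * (g + 1) = 1}

theorem ncard_twistedSet [IsAlgClosed Ω] (hm : 0 < m) :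
    (twistedSet Ω m).ncard = 2 ^ m + 1 := by
  classical
  set P : Polynomial Ω := Polynomial.X ^ 2 ^ m * (Polynomial.X + 1) + 1 with hP
  have h2 : (2 : Polynomial Ω) = 0 := CharTwo.two_eq_zero
  have hdegQ : (Polynomial.X ^ 2 ^ m * (Polynomial.X + 1) : Polynomial Ω).natDegree
      = 2 ^ m + 1 := by
    rw [← Polynomial.C_1, (Polynomial.monic_X_pow _).natDegree_mul (Polynomial.monic_X_add_C 1),
      Polynomial.natDegree_X_pow, Polynomial.natDegree_X_add_C]
  have hdeg : P.natDegree = 2 ^ m + 1 := by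
    rw [hP, ← Polynomial.C_1, Polynomial.natDegree_add_C, Polynomial.C_1, hdegQ]
  have hP0 : P ≠ 0 := by
    intro h
    rw [h] at hdeg
    simp at hdeg
  have hder : Polynomial.derivative P = Polynomial.X ^ 2 ^ m := by
    simp only [hP, Polynomial.derivative_add, Polynomial.derivative_mul,
      Polynomial.derivative_X_pow, Polynomial.derivative_X, Polynomial.derivative_one]
    simp [hm.ne']
    exact Or.inl CharTwo.two_eq_zero
  have hsep : P.Separable := by
    rw [Polynomial.separable_def, hder]
    -- Bézout relation: P + (X + 1) P' = 1 modulo 2.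
    exact ⟨1, Polynomial.X + 1, by
      rw [hP]; linear_combination (Polynomial.X ^ 2 ^ m * (Polynomial.X + 1)) * h2⟩
  have hcard := Polynomial.card_rootSet_eq_natDegree (K := Ω) hsep (IsAlgClosed.splits _)
  rw [hdeg, ← Nat.card_eq_fintype_card, Nat.card_coe_set_eq] at hcard
  rw [← hcard]
  congr 1
  ext g
  rw [Polynomial.mem_rootSet, and_iff_right hP0]
  simp [twistedSet, hP, CharTwo.add_eq_zero]

theorem twistedSet_ne_zero {Ω : Type*} [Field Ω] {m : ℕ} {g : Ω} (hg : g ∈ twistedSet Ω m) : g ≠ 0 := by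
  rintro rfl
  simp [twistedSet] at hg

theorem twistedSet_add_one_ne_zero {Ω : Type*} [Field Ω] {m : ℕ} {g : Ω} (hg : g ∈ twistedSet Ω m) : g + 1 ≠ 0 := by
  intro h
  rw [twistedSet, Set.mem_ofPred_eq, h, mul_zero] at hg
  exact zero_ne_one hg

theorem twistedSet_pow_eq {Ω : Type*} [Field Ω] {m : ℕ} {g : Ω} (hg : g ∈ twistedSet Ω m) : g ^ 2 ^ m = (g + 1)⁻¹ :=
  eq_inv_of_mul_eq_one_left hg

theorem pow_mem_twistedSet {g : Ω} (hg : g ∈ twistedSet Ω m) (n : ℕ) :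
    g ^ 2 ^ n ∈ twistedSet Ω m := by
  have : (g ^ 2 ^ m * (g + 1)) ^ 2 ^ n = 1 := by rw [show _ = _ from hg, one_pow]
  rw [mul_pow, add_pow_char_pow, one_pow, ← pow_mul, mul_comm (2 ^ m), pow_mul] at this
  exact this

/-- Frobenius acts on g as the Möbius map g ↦ 1/(g+1), which has order 3 in characteristic 2. -/
theorem twistedSet_subset_fixedPow {g : Ω} (hg : g ∈ twistedSet Ω m) :
    g ∈ fixedPow Ω (m * 3) := by
  have h2 : (2 : Ω) = 0 := CharTwo.two_eq_zero
  have ha := pow_mem_twistedSet hg m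
  have hb := pow_mem_twistedSet ha m
  have e1 := twistedSet_pow_eq hg
  have e2 := twistedSet_pow_eq ha
  have e3 := twistedSet_pow_eq hb
  have h0 := twistedSet_ne_zero hg
  have h1 := twistedSet_add_one_ne_zero hg
  rw [mem_fixedPow, show m * 3 = m + m + m by ring, pow_add, pow_add, pow_mul, pow_mul, e3, e2,
    e1]
  have e4 : (g + 1)⁻¹ + 1 = g / (g + 1) := by
    field_simp
    linear_combination h2
  have e5 : (g / (g + 1))⁻¹ + 1 = g⁻¹ := by
    field_simp
    linear_combination g * h2
  rw [e4, e5, inv_inv]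

/-- Being fixed by the exponents 2k and 3m puts g in F_4 (m even) or F_2 (m odd), and g is neither 0
nor 1. -/
theorem sq_add_eq_one_of_mem_twistedSet (hkm : k.Coprime (m * 3)) {g : Ω}
    (hg : g ∈ twistedSet Ω m) (h : (g ^ 2 ^ k) ^ 2 ^ k = g) : Even m ∧ g ^ 2 + g = 1 := by
  have hk2 : g ∈ fixedPow Ω (k * 2) := mem_fixedPow.2 (by
    rw [mul_two, pow_add, pow_mul, h])
  have h0 := twistedSet_ne_zero hg
  have h1 := twistedSet_add_one_ne_zero hg
  have hgcd := mem_fixedPow_gcd.2 ⟨hk2, twistedSet_subset_fixedPow hg⟩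
  rw [hkm.gcd_mul_left_cancel] at hgcd
  rcases Nat.even_or_odd m with hm | hm
  · refine ⟨hm, ?_⟩
    have h4 := mem_fixedPow.1 (fixedPow_le (Nat.gcd_dvd_left _ _) hgcd)
    refine mul_left_cancel₀ (mul_ne_zero h0 h1) ?_
    linear_combination h4 + (g ^ 3) * CharTwo.two_eq_zero (R := Ω)
  · exfalso
    have : Nat.gcd 2 (m * 3) = 1 := Nat.coprime_two_left.2 (hm.mul (by decide))
    rw [this, mem_fixedPow, pow_one] at hgcd
    refine mul_ne_zero h0 h1 ?_
    linear_combination hgcd + g * CharTwo.two_eq_zero (R := Ω)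

theorem ncard_twistedSet_inter_le (hkm : k.Coprime (m * 3)) :
    ({g ∈ twistedSet Ω m | (g ^ 2 ^ k) ^ 2 ^ k = g}).ncard ≤ if Even m then 2 else 0 := by
  rcases Set.eq_empty_or_nonempty {g ∈ twistedSet Ω m | (g ^ 2 ^ k) ^ 2 ^ k = g} with h | ⟨u, hu⟩
  · rw [h]; simp
  obtain ⟨hm, hu⟩ := sq_add_eq_one_of_mem_twistedSet hkm hu.1 hu.2
  rw [if_pos hm]
  refine le_trans (Set.ncard_le_ncard (t := {u, u + 1}) ?_ (Set.toFinite _))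
    ((Set.ncard_insert_le _ _).trans (by rw [Set.ncard_singleton]))
  rintro v ⟨hv, hv'⟩
  obtain ⟨-, hv⟩ := sq_add_eq_one_of_mem_twistedSet hkm hv hv'
  have : (v - u) * (v + u + 1) = 0 := by linear_combination hv - hu
  rcases mul_eq_zero.1 this with h | h
  · exact Or.inl (sub_eq_zero.1 h)
  · rw [add_assoc] at h
    exact Or.inr (CharTwo.add_eq_zero.1 h)

/-- The preimage of a value of the trinomial map attached to a parameter `g`. -/
def rootParam {Ω : Type*} [Field Ω] (k : ℕ) (g : Ω) : Ω := (g ^ 2 ^ k + g) / ((g ^ 2 ^ k) ^ 2 ^ k + g)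

theorem rootParam_mem {Ω : Type*} [Field Ω] {k : ℕ} {K : Subfield Ω} {g : Ω} (hg : g ∈ K) : rootParam k g ∈ K :=
  K.div_mem (K.add_mem (K.pow_mem hg _) hg) (K.add_mem (K.pow_mem (K.pow_mem hg _) _) hg)

/-- With b, c, d the successive 2^k-th powers of g, x = (b+g)/(c+g) satisfies x^(2^k) + 1 =
(c+d)/(b+d). So f(x) = x(x^(2^k) + 1) is a cross ratio of g, b, c, d. -/
theorem trinomial_rootParam {g : Ω} (hg : (g ^ 2 ^ k) ^ 2 ^ k ≠ g) :
    trinomial k (rootParam k g) = (g + g ^ 2 ^ k) * ((g ^ 2 ^ k) ^ 2 ^ k +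
      ((g ^ 2 ^ k) ^ 2 ^ k) ^ 2 ^ k) / ((g + (g ^ 2 ^ k) ^ 2 ^ k) *
      (g ^ 2 ^ k + ((g ^ 2 ^ k) ^ 2 ^ k) ^ 2 ^ k)) := by
  have h2 : (2 : Ω) = 0 := CharTwo.two_eq_zero
  have h1 : (g ^ 2 ^ k) ^ 2 ^ k + g ≠ 0 := fun h => hg (CharTwo.add_eq_zero.1 h)
  have h3 : ((g ^ 2 ^ k) ^ 2 ^ k) ^ 2 ^ k + g ^ 2 ^ k ≠ 0 := by
    rw [← add_pow_char_pow]; exact pow_ne_zero _ h1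
  rw [trinomial, pow_succ, rootParam, div_pow, add_pow_char_pow, add_pow_char_pow]
  generalize ((g ^ 2 ^ k) ^ 2 ^ k) ^ 2 ^ k = d at *
  generalize (g ^ 2 ^ k) ^ 2 ^ k = c at *
  generalize g ^ 2 ^ k = b at *
  rw [add_comm g c, add_comm b d]
  field_simp
  linear_combination b * (g + b) * h2

/-- The q-Frobenius applies one Möbius map to all four points, and cross ratios are Möbius
invariant. -/
theorem trinomial_rootParam_mem {g : Ω} (hg : g ∈ twistedSet Ω m)
    (hg' : (g ^ 2 ^ k) ^ 2 ^ k ≠ g) : trinomial k (rootParam k g) ∈ fixedPow Ω m := by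
  have h2 : (2 : Ω) = 0 := CharTwo.two_eq_zero
  rw [mem_fixedPow, trinomial_rootParam hg']
  have hb := pow_mem_twistedSet hg k
  have hc := pow_mem_twistedSet hb k
  have hd := pow_mem_twistedSet hc k
  have h1 : g + (g ^ 2 ^ k) ^ 2 ^ k ≠ 0 := fun h => hg' (CharTwo.add_eq_zero.1 h).symm
  have h3 : g ^ 2 ^ k + ((g ^ 2 ^ k) ^ 2 ^ k) ^ 2 ^ k ≠ 0 := by
    rw [← add_pow_char_pow]; exact pow_ne_zero _ h1
  generalize ((g ^ 2 ^ k) ^ 2 ^ k) ^ 2 ^ k = d at *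
  generalize (g ^ 2 ^ k) ^ 2 ^ k = c at *
  generalize g ^ 2 ^ k = b at *
  have key : ∀ x ∈ twistedSet Ω m, ∀ y ∈ twistedSet Ω m,
      (x + y) ^ 2 ^ m = (x + y) / ((x + 1) * (y + 1)) := by
    intro x hx y hy
    have hx1 := twistedSet_add_one_ne_zero hx
    have hy1 := twistedSet_add_one_ne_zero hy
    rw [add_pow_char_pow, twistedSet_pow_eq hx, twistedSet_pow_eq hy]
    field_simp
    linear_combination h2
  rw [div_pow, mul_pow, mul_pow, key g hg b hb, key c hc d hd, key g hg c hc, key b hb d hd]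
  have ha1 := twistedSet_add_one_ne_zero hg
  have hb1 := twistedSet_add_one_ne_zero hb
  have hc1 := twistedSet_add_one_ne_zero hc
  have hd1 := twistedSet_add_one_ne_zero hd
  field_simp

/-- Frobenius multiplies the parameter by (c+1)/(b+1), which is not 1. -/
theorem rootParam_notMem {g : Ω} (hg : g ∈ twistedSet Ω m)
    (hg' : (g ^ 2 ^ k) ^ 2 ^ k ≠ g) : rootParam k g ∉ fixedPow Ω m := by
  have h2 : (2 : Ω) = 0 := CharTwo.two_eq_zero
  have hb := pow_mem_twistedSet hg k
  have hc := pow_mem_twistedSet hb k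
  have hgb : g ^ 2 ^ k ≠ g := fun h => hg' (by rw [h, h])
  have hbc : (g ^ 2 ^ k) ^ 2 ^ k ≠ g ^ 2 ^ k := fun h => hgb (pow_two_pow_injective k h)
  rw [mem_fixedPow, rootParam, div_pow, add_pow_char_pow, add_pow_char_pow,
    twistedSet_pow_eq hg, twistedSet_pow_eq hb, twistedSet_pow_eq hc]
  have h1 : (g ^ 2 ^ k) ^ 2 ^ k + g ≠ 0 := fun h => hg' (CharTwo.add_eq_zero.1 h)
  have h3 : g ^ 2 ^ k + g ≠ 0 := fun h => hgb (CharTwo.add_eq_zero.1 h)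
  have ha1 := twistedSet_add_one_ne_zero hg
  have hb1 := twistedSet_add_one_ne_zero hb
  have hc1 := twistedSet_add_one_ne_zero hc
  generalize (g ^ 2 ^ k) ^ 2 ^ k = c at *
  generalize g ^ 2 ^ k = b at *
  have key : ∀ x y : Ω, x + 1 ≠ 0 → y + 1 ≠ 0 →
      (x + 1)⁻¹ + (y + 1)⁻¹ = (x + y) / ((x + 1) * (y + 1)) := by
    intro x y hx1 hy1
    field_simp
    linear_combination h2
  rw [key _ _ hb1 ha1, key _ _ hc1 ha1]
  intro h
  have h4 : (b + g) / ((b + 1) * (g + 1)) / ((c + g) / ((c + 1) * (g + 1)))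
      = (b + g) / (c + g) * ((c + 1) / (b + 1)) := by field_simp
  rw [h4, mul_eq_left₀ (div_ne_zero h3 h1), div_eq_one_iff_eq hb1] at h
  exact hbc (add_right_cancel h)

/-- With s = g^(2^k) + g the parameter is s/(s^(2^k) + s), which determines s^(2^k-1), hence s,
hence g up to adding 1. If g and g + 1 both lie in the twisted set, then g is in F_4, which is
excluded. -/
theorem rootParam_injOn (hkm : k.Coprime (m * 3)) :
    Set.InjOn (rootParam k) {g ∈ twistedSet Ω m | (g ^ 2 ^ k) ^ 2 ^ k ≠ g} := by
  have h2 : (2 : Ω) = 0 := CharTwo.two_eq_zero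
  rintro g ⟨hg, hg'⟩ h ⟨hh, hh'⟩ e
  have hne : ∀ x : Ω, (x ^ 2 ^ k) ^ 2 ^ k ≠ x →
      (x ^ 2 ^ k) ^ 2 ^ k + x ≠ 0 ∧ x ^ 2 ^ k + x ≠ 0 := fun x hx =>
    ⟨fun h => hx (CharTwo.add_eq_zero.1 h), fun h => hx (by
      have := CharTwo.add_eq_zero.1 h
      rw [this, this])⟩
  have hfix : ∀ x ∈ twistedSet Ω m, x ^ 2 ^ k + x ∈ fixedPow Ω (m * 3) := fun x hx =>
    add_mem (pow_mem (twistedSet_subset_fixedPow hx) _) (twistedSet_subset_fixedPow hx)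
  rw [rootParam, rootParam, div_eq_div_iff (hne g hg').1 (hne h hh').1] at e
  have hs : g ^ 2 ^ k + g = h ^ 2 ^ k + h := by
    refine eq_of_pow_mul_eq hkm (mem_fixedPow.1 (hfix g hg)) (mem_fixedPow.1 (hfix h hh))
      (hne g hg').2 (hne h hh').2 ?_
    rw [add_pow_char_pow, add_pow_char_pow]
    linear_combination -e + (g ^ 2 ^ k * h - g * h ^ 2 ^ k) * h2
  have hgh : (g + h) ^ 2 ^ k = g + h := by
    rw [add_pow_char_pow]
    linear_combination hs + (h ^ 2 ^ k - g) * h2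
  rcases eq_zero_or_one_of_coprime hkm (mem_fixedPow.1 (add_mem
    (twistedSet_subset_fixedPow hg) (twistedSet_subset_fixedPow hh))) hgh with h0 | h1
  · exact CharTwo.add_eq_zero.1 h0
  · exfalso
    have hh1 : h = g + 1 := by linear_combination h1 - g * h2
    have e1 : g ^ 2 ^ m * (g + 1) = 1 := hg
    have e2 : (g + 1) ^ 2 ^ m * (g + 1 + 1) = 1 := hh1 ▸ hh
    rw [add_pow_char_pow, one_pow] at e2
    have e3 : g ^ 2 ^ m = g := by
      linear_combination e1 - e2 + (g ^ 2 ^ m + 1) * h2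
    rw [e3] at e1
    have h4 : g ∈ fixedPow Ω 2 := mem_fixedPow.2 (by
      linear_combination (g ^ 2 - g) * e1 + (g ^ 2 - g) * h2)
    have := mem_fixedPow.1 (fixedPow_le (dvd_mul_left 2 k) h4)
    rw [mul_two, pow_add, pow_mul] at this
    exact hg' this

end Cubic

/-! ### Non-values acquire roots in the cubic extension -/

section Extension

variable {Ω : Type*} [Field Ω] [CharP Ω 2] [IsAlgClosed Ω] {k m : ℕ}

/-- A proper cubic point whose trinomial value is rational has exactly its conjugates as
preimages of that value. -/
theorem eq_conjugate_of_trinomial_eq (hkm : k.Coprime (m * 3)) (hm : 0 < m) {x : Ω}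
    (hx3 : x ∈ fixedPow Ω (m * 3)) (hx : x ∉ fixedPow Ω m)
    (hf : trinomial k x ∈ fixedPow Ω m) {t : Ω} (ht : t ∈ fixedPow Ω (m * 3))
    (htx : trinomial k t = trinomial k x) :
    t = x ∨ t = x ^ 2 ^ m ∨ t = (x ^ 2 ^ m) ^ 2 ^ m := by
  have hb : trinomial k x ≠ 0 := by
    intro h
    rcases trinomial_eq_zero.1 h with rfl | rfl
    · exact hx (zero_mem _)
    · exact hx (one_mem _)
  rw [mem_fixedPow] at hx hf
  have hinj := pow_two_pow_injective (E := Ω) m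
  refine eq_of_three_roots hkm (by omega) hb hx3 (pow_mem hx3 _) (pow_mem (pow_mem hx3 _) _) ht
    rfl (by rw [trinomial_pow, hf]) (by rw [trinomial_pow, trinomial_pow, hf, hf]) htx
    (Ne.symm hx) ?_ (fun h => hx (hinj h.symm))
  intro h
  rw [mem_fixedPow, show m * 3 = m + m + m by ring, pow_add, pow_add, pow_mul, pow_mul, ← h] at hx3
  exact hx hx3

/-- A root in F_q would be a conjugate of x, forcing x into F_q. -/
theorem trinomial_mem_nonValues (hkm : k.Coprime (m * 3)) (hm : 0 < m) {x : Ω}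
    (hx3 : x ∈ fixedPow Ω (m * 3)) (hx : x ∉ fixedPow Ω m)
    (hf : trinomial k x ∈ fixedPow Ω m) : trinomial k x ∈ nonValues Ω k m := by
  refine ⟨hf, fun t ht htx => hx ?_⟩
  have hinj := pow_two_pow_injective (E := Ω) m
  rcases eq_conjugate_of_trinomial_eq hkm hm hx3 hx hf (fixedPow_le (dvd_mul_right m 3) ht) htx
    with rfl | rfl | rfl
  · exact ht
  · exact mem_fixedPow.2 (hinj (mem_fixedPow.1 ht))
  · exact mem_fixedPow.2 (hinj (hinj (mem_fixedPow.1 ht)))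

theorem nonValues_finite (k : ℕ) (hm : 0 < m) : (nonValues Ω k m).Finite := by
  have : Finite ((fixedPow Ω m : Set Ω)) := finite_fixedPow hm
  exact (Set.toFinite (fixedPow Ω m : Set Ω)).subset fun _ h => h.1

/-- A non-value of the trinomial map becomes a value over the cubic extension. -/
theorem exists_root_of_mem_nonValues (hkm : k.Coprime (m * 3)) (hm : 0 < m) {b : Ω}
    (hb : b ∈ nonValues Ω k m) : ∃ x ∈ fixedPow Ω (m * 3), trinomial k x = b := by
  classical
  have hTfin : (twistedSet Ω m).Finite :=
    Set.finite_of_ncard_ne_zero (by rw [ncard_twistedSet hm]; exact Nat.succ_ne_zero _)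
  set G : Set Ω := {g ∈ twistedSet Ω m | (g ^ 2 ^ k) ^ 2 ^ k ≠ g}
  have hGfin : G.Finite := hTfin.subset fun _ h => h.1
  have hGcard : 2 ^ m + 1 ≤ G.ncard + if Even m then 2 else 0 := by
    refine le_trans ?_ (Nat.add_le_add_left (ncard_twistedSet_inter_le (Ω := Ω) hkm) _)
    rw [← ncard_twistedSet (Ω := Ω) hm]
    refine le_trans (Set.ncard_le_ncard ?_ (hGfin.union (hTfin.subset fun _ h => h.1)))
      (Set.ncard_union_le _ _)
    intro g hg
    by_cases h : (g ^ 2 ^ k) ^ 2 ^ k = g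
    · exact Or.inr ⟨hg, h⟩
    · exact Or.inl ⟨hg, h⟩
  set ψ : Ω → Ω := fun g => trinomial k (rootParam k g)
  have hsub : ψ '' G ⊆ nonValues Ω k m := by
    rintro _ ⟨g, ⟨hg, hg'⟩, rfl⟩
    exact trinomial_mem_nonValues hkm hm (rootParam_mem (twistedSet_subset_fixedPow hg))
      (rootParam_notMem hg hg') (trinomial_rootParam_mem hg hg')
  -- Parameters with the same value map injectively into the three conjugates of one root.
  have hfib : G.ncard ≤ 3 * (ψ '' G).ncard := by
    rw [← hGfin.coe_toFinset, ← Finset.coe_image, Set.ncard_coe_finset, Set.ncard_coe_finset]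
    refine Finset.card_le_mul_card_image _ 3 fun c hc => ?_
    obtain ⟨g, hgG, rfl⟩ := Finset.mem_image.1 hc
    obtain ⟨hg, hg'⟩ := hGfin.mem_toFinset.1 hgG
    set x := rootParam k g
    refine le_trans (Finset.card_le_card_of_injOn (rootParam k)
      (t := {x, x ^ 2 ^ m, (x ^ 2 ^ m) ^ 2 ^ m}) ?_ ?_) Finset.card_le_three
    · intro h hh
      simp only [Finset.coe_filter, Set.mem_ofPred_eq, Set.Finite.mem_toFinset] at hh
      simp only [Finset.coe_insert, Finset.coe_singleton, Set.mem_insert_iff,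
        Set.mem_singleton_iff]
      exact eq_conjugate_of_trinomial_eq hkm hm (rootParam_mem (twistedSet_subset_fixedPow hg))
        (rootParam_notMem hg hg') (trinomial_rootParam_mem hg hg')
        (rootParam_mem (twistedSet_subset_fixedPow hh.1.1)) hh.2
    · refine (rootParam_injOn hkm).mono fun h hh => ?_
      simp only [Finset.coe_filter, Set.mem_ofPred_eq, Set.Finite.mem_toFinset] at hh
      exact hh.1
  have hcount := three_mul_card_nonValues (Ω := Ω) (hkm.coprime_dvd_right (dvd_mul_right m 3)) hm
  -- The bounds close up: 3 · #(image) is at least 2^m + 1, less 2 for even m, which is exactly 3 ·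
  -- #(non-values).
  have heq := Set.eq_of_subset_of_ncard_le hsub (by omega) (nonValues_finite k hm)
  rw [← heq] at hb
  obtain ⟨g, hg, rfl⟩ := hb
  exact ⟨_, rootParam_mem (twistedSet_subset_fixedPow hg.1), rfl⟩

theorem nonValues_inter_fixedPow {d : ℕ} (hkm : k.Coprime (m * d)) (hm : 0 < m * d)
    (hd : ¬ 3 ∣ d) : nonValues Ω k (m * d) ∩ fixedPow Ω m = nonValues Ω k m := by
  ext b
  constructor
  · rintro ⟨⟨-, h⟩, hb⟩
    exact ⟨hb, fun x hx => h x (fixedPow_le (dvd_mul_right m d) hx)⟩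
  · exact fun h => ⟨nonValues_subset_of_not_three_dvd hkm hm hd h, h.1⟩

theorem notMem_fixedPow_of_mem_nonValues (hkm : k.Coprime (m * 3)) (hm : 0 < m) {b : Ω}
    (hb : b ∈ nonValues Ω k (m * 3)) : b ∉ fixedPow Ω m := by
  intro hbm
  obtain ⟨x, hx, hxb⟩ := exists_root_of_mem_nonValues hkm hm
    (show b ∈ nonValues Ω k m from
      ⟨hbm, fun x hx => hb.2 x (fixedPow_le (dvd_mul_right m 3) hx)⟩)
  exact hb.2 x hx hxb

end Extension

/-! ### Transfer from the given field to its algebraic closure -/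

section Descent

variable {F : Type*} [Field F] [CharP F 2] {k m : ℕ}

theorem exists_subfield_mem_iff (hm : 0 < m) (hF : Nat.card F = 2 ^ m) {d : ℕ} (hd : d ∣ m)
    (b : F) : (∃ K : Subfield F, Nat.card K = 2 ^ d ∧ b ∈ K) ↔
      algebraMap F (AlgebraicClosure F) b ∈ fixedPow (AlgebraicClosure F) d := by
  have hd0 : 0 < d := Nat.pos_of_dvd_of_pos hd hm
  set ι := algebraMap F (AlgebraicClosure F)
  have hι : Function.Injective ι := ι.injective
  constructor
  · rintro ⟨K, hK, hb⟩
    exact (mem_fixedPow_iff_exists hd0 hK (ι.comp K.subtype)).2 ⟨⟨b, hb⟩, rfl⟩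
  · intro hb
    refine ⟨(fixedPow (AlgebraicClosure F) d).comap ι, ?_, hb⟩
    rw [← card_fixedPow (Ω := AlgebraicClosure F) hd0]
    refine Nat.card_congr (Equiv.ofBijective
      (fun x : (fixedPow (AlgebraicClosure F) d).comap ι =>
        (⟨ι x, x.2⟩ : fixedPow (AlgebraicClosure F) d)) ⟨?_, ?_⟩)
    · intro x y h
      exact Subtype.ext (hι (congrArg Subtype.val h))
    · rintro ⟨y, hy⟩
      obtain ⟨x, rfl⟩ := (mem_fixedPow_iff_exists hm hF ι).1 (fixedPow_le hd hy)
      exact ⟨⟨x, hy⟩, rfl⟩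

theorem N_eq_ncard (hm : 0 < m) (hF : Nat.card F = 2 ^ m) :
    N k m F = {b ∈ nonValues (AlgebraicClosure F) k m |
      ∀ d, d ∣ m → d < m → b ∉ fixedPow (AlgebraicClosure F) d}.ncard := by
  set ι := algebraMap F (AlgebraicClosure F)
  rw [N, ← Set.ncard_image_of_injective _ ι.injective]
  congr 1
  ext y
  constructor
  · rintro ⟨b, ⟨hb, h⟩, rfl⟩
    refine ⟨(mem_nonValues_iff hm hF ι).2 hb, fun d hd hdm hbd => ?_⟩
    obtain ⟨K, hK, hbK⟩ := (exists_subfield_mem_iff hm hF hd b).2 hbd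
    exact h d hd hdm K hK hbK
  · rintro ⟨hy, h⟩
    obtain ⟨b, rfl⟩ := (mem_fixedPow_iff_exists hm hF ι).1 hy.1
    exact ⟨b, ⟨(mem_nonValues_iff hm hF ι).1 hy, fun d hd hdm K hK hbK =>
      h d hd hdm ((exists_subfield_mem_iff hm hF hd b).1 ⟨K, hK, hbK⟩)⟩, rfl⟩

end Descent

/-! ### Intersections of subfields of prime index -/

section Combinatorics

variable {ι : Type*} {p : ι → ℕ}

theorem gcd_div_div_of_coprime {m a b : ℕ} (hab : a.Coprime b) (h : a * b ∣ m) (hm : 0 < m) :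
    (m / a).gcd (m / b) = m / (a * b) := by
  obtain ⟨c, rfl⟩ := h
  have ha : 0 < a := Nat.pos_of_ne_zero (by rintro rfl; simp at hm)
  have hb : 0 < b := Nat.pos_of_ne_zero (by rintro rfl; simp at hm)
  rw [show a * b * c / a = b * c by rw [mul_assoc, Nat.mul_div_cancel_left _ ha],
    show a * b * c / b = a * c by
      rw [mul_comm a b, mul_assoc, Nat.mul_div_cancel_left _ hb],
    Nat.mul_div_cancel_left _ (Nat.mul_pos ha hb), Nat.gcd_mul_right, hab.symm.gcd_eq_one,
    one_mul]

theorem coprime_prod_of_notMem (hp : ∀ i, (p i).Prime) (hinj : Function.Injective p)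
    {i : ι} {T : Finset ι} (hi : i ∉ T) : (p i).Coprime (∏ j ∈ T, p j) :=
  Nat.Coprime.prod_right fun j hj => (Nat.coprime_primes (hp i) (hp j)).2 fun h =>
    hi (hinj h ▸ hj)

theorem mem_fixedPow_div_prod {Ω : Type*} [Field Ω] [CharP Ω 2] {m : ℕ} (hm : 0 < m)
    (hp : ∀ i, (p i).Prime) (hinj : Function.Injective p) {b : Ω} (hb : b ∈ fixedPow Ω m)
    (T : Finset ι) (hT : ∏ i ∈ T, p i ∣ m) :
    b ∈ fixedPow Ω (m / ∏ i ∈ T, p i) ↔ ∀ i ∈ T, b ∈ fixedPow Ω (m / p i) := by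
  classical
  induction T using Finset.induction_on with
  | empty => simpa using hb
  | insert i T hi ih =>
    rw [Finset.prod_insert hi] at hT ⊢
    rw [← gcd_div_div_of_coprime (coprime_prod_of_notMem hp hinj hi) hT hm, mem_fixedPow_gcd,
      ih ((dvd_mul_left _ _).trans hT), Finset.forall_mem_insert]

end Combinatorics

/-! ### Inclusion–exclusion and the sign sum -/

section Main

variable {F : Type*} [Field F] [CharP F 2] {k m n₀ t : ℕ} {p n : Fin t → ℕ}

theorem prod_dvd_of_eq (hn : ∀ i, 0 < n i) (hm : m = 3 ^ n₀ * ∏ i, p i ^ n i)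
    (T : Finset (Fin t)) : ∏ i ∈ T, p i ∣ m := by
  rw [hm]
  refine Dvd.dvd.mul_left ?_ _
  exact (Finset.prod_dvd_prod_of_dvd _ _ fun i _ => dvd_pow_self (p i) (hn i).ne').trans
    (Finset.prod_dvd_prod_of_subset _ _ _ (Finset.subset_univ T))

theorem not_three_dvd_prod (hp : ∀ i, (p i).Prime) (hp3 : ∀ i, p i ≠ 3) (T : Finset (Fin t)) :
    ¬ 3 ∣ ∏ i ∈ T, p i := by
  intro h
  obtain ⟨i, -, hi⟩ := (Nat.prime_three.prime.dvd_finsetProd_iff _).1 h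
  exact hp3 i ((Nat.prime_dvd_prime_iff_eq Nat.prime_three (hp i)).1 hi).symm

/-- A proper subfield lies in one of prime index. Index 3 needs no condition, since a non-value
never lies there. -/
theorem forall_notMem_fixedPow_iff {Ω : Type*} [Field Ω] [CharP Ω 2] [IsAlgClosed Ω]
    (hkm : k.Coprime m) (hm0 : 0 < m) (hp : ∀ i, (p i).Prime) (hn : ∀ i, 0 < n i)
    (hm : m = 3 ^ n₀ * ∏ i, p i ^ n i) {b : Ω} (hb : b ∈ nonValues Ω k m) :
    (∀ d, d ∣ m → d < m → b ∉ fixedPow Ω d) ↔ ∀ i, b ∉ fixedPow Ω (m / p i) := by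
  constructor
  · intro h i
    have hi : p i ∣ m := by simpa using prod_dvd_of_eq hn hm {i}
    exact h _ (Nat.div_dvd_of_dvd hi) (Nat.div_lt_self hm0 (hp i).one_lt)
  · rintro h d ⟨e, rfl⟩ hdm hbd
    have he : e ≠ 1 := by rintro rfl; simp at hdm
    obtain ⟨l, hl, c, rfl⟩ := Nat.exists_prime_and_dvd he
    have hbl : b ∈ fixedPow Ω (d * c) := fixedPow_le (dvd_mul_right d c) hbd
    have hdc : d * (l * c) = d * c * l := by ring
    rw [hdc] at hb hkm hm0 hm h
    have hlm : l ∣ 3 ^ n₀ * ∏ i, p i ^ n i := hm ▸ dvd_mul_left l (d * c)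
    rcases (hl.dvd_mul).1 hlm with h3 | hpi
    · have := (Nat.prime_dvd_prime_iff_eq hl Nat.prime_three).1 (hl.dvd_of_dvd_pow h3)
      subst this
      exact notMem_fixedPow_of_mem_nonValues hkm (by omega) hb hbl
    · obtain ⟨i, -, hi⟩ := (hl.prime.dvd_finsetProd_iff _).1 hpi
      have := (Nat.prime_dvd_prime_iff_eq hl (hp i)).1 (hl.dvd_of_dvd_pow hi)
      subst this
      refine h i ?_
      rwa [Nat.mul_div_cancel _ hl.pos]

theorem N_eq_sum (hkm : k.Coprime m) (hF : Nat.card F = 2 ^ m) (hm0 : 0 < m)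
    (hp : ∀ i, (p i).Prime) (hp3 : ∀ i, p i ≠ 3) (hinj : Function.Injective p)
    (hn : ∀ i, 0 < n i) (hm : m = 3 ^ n₀ * ∏ i, p i ^ n i) :
    (N k m F : ℤ) = ∑ T ∈ (Finset.univ : Finset (Fin t)).powerset, (-1) ^ T.card *
      ((nonValues (AlgebraicClosure F) k (m / ∏ i ∈ T, p i)).ncard : ℤ) := by
  classical
  set Ω := AlgebraicClosure F
  have hfin := nonValues_finite (Ω := Ω) k hm0
  have := hfin.to_subtype
  have := Fintype.ofFinite (nonValues Ω k m)
  have key := Finset.inclusion_exclusion_card_inf_compl (Finset.univ : Finset (Fin t))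
    fun i => Finset.univ.filter fun b : nonValues Ω k m => (b : Ω) ∈ fixedPow Ω (m / p i)
  have hcount : ∀ (Q : Ω → Prop) (S : Finset (nonValues Ω k m)),
      (∀ b, b ∈ S ↔ Q b) → S.card = {b ∈ nonValues Ω k m | Q b}.ncard := by
    intro Q S hS
    rw [← Set.ncard_coe_finset, ← Set.ncard_image_of_injective _ Subtype.val_injective]
    congr 1
    ext b
    constructor
    · rintro ⟨b, hb, rfl⟩
      exact ⟨b.2, (hS b).1 hb⟩
    · rintro ⟨hb, hQ⟩
      exact ⟨⟨b, hb⟩, (hS _).2 hQ, rfl⟩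
  rw [hcount (fun b => ∀ i, b ∉ fixedPow Ω (m / p i)) _ (by
    intro b
    simp [Finset.mem_inf])] at key
  rw [N_eq_ncard hm0 hF]
  have hset : {b ∈ nonValues Ω k m | ∀ d, d ∣ m → d < m → b ∉ fixedPow Ω d}
      = {b ∈ nonValues Ω k m | ∀ i, b ∉ fixedPow Ω (m / p i)} := by
    ext b
    exact and_congr_right fun hb => forall_notMem_fixedPow_iff hkm hm0 hp hn hm hb
  rw [hset, key]
  refine Finset.sum_congr rfl fun T _ => ?_
  congr 2
  have hT := prod_dvd_of_eq hn hm T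
  rw [hcount (fun b => ∀ i ∈ T, b ∈ fixedPow Ω (m / p i)) _ (by
    intro b
    simp [Finset.mem_inf])]
  have hmT : m / (∏ i ∈ T, p i) * ∏ i ∈ T, p i = m := Nat.div_mul_cancel hT
  have := nonValues_inter_fixedPow (Ω := Ω) (m := m / ∏ i ∈ T, p i) (d := ∏ i ∈ T, p i)
    (k := k) (by rwa [hmT]) (by rwa [hmT]) (not_three_dvd_prod hp hp3 T)
  rw [← this, hmT]
  congr 1
  ext b
  exact and_congr_right fun hb => (mem_fixedPow_div_prod hm0 hp hinj hb.1 T hT).symm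

theorem three_mul_N (hkm : k.Coprime m) (hF : Nat.card F = 2 ^ m) (hm0 : 0 < m)
    (hp : ∀ i, (p i).Prime) (hp3 : ∀ i, p i ≠ 3) (hinj : Function.Injective p)
    (hn : ∀ i, 0 < n i) (hm : m = 3 ^ n₀ * ∏ i, p i ^ n i) :
    3 * (N k m F : ℤ) = ∑ T ∈ (Finset.univ : Finset (Fin t)).powerset, (-1) ^ T.card *
      2 ^ (m / ∏ i ∈ T, p i) + ∑ T ∈ (Finset.univ : Finset (Fin t)).powerset, (-1) ^ T.card *
      (if Even (m / ∏ i ∈ T, p i) then -1 else 1) := by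
  rw [N_eq_sum hkm hF hm0 hp hp3 hinj hn hm, Finset.mul_sum, ← Finset.sum_add_distrib]
  refine Finset.sum_congr rfl fun T _ => ?_
  have hT := prod_dvd_of_eq hn hm T
  have h3 := three_mul_card_nonValues (Ω := AlgebraicClosure F) (k := k)
    (hkm.coprime_dvd_right (Nat.div_dvd_of_dvd hT))
    (Nat.div_pos (Nat.le_of_dvd hm0 hT) (Nat.pos_of_dvd_of_pos hT hm0))
  rw [← mul_add]
  zify at h3
  rw [mul_left_comm]
  congr 1
  split_ifs at h3 ⊢ <;> linarith

theorem even_div_iff {i₀ : Fin t} (hp : ∀ i, (p i).Prime) (hinj : Function.Injective p)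
    (h2 : p i₀ = 2) (hm4 : m ≡ 2 [MOD 4]) {T : Finset (Fin t)} (hT : ∏ i ∈ T, p i ∣ m) :
    Even (m / ∏ i ∈ T, p i) ↔ i₀ ∉ T := by
  have hmT : m / (∏ i ∈ T, p i) * ∏ i ∈ T, p i = m := Nat.div_mul_cancel hT
  have hm4' : m % 4 = 2 := hm4
  constructor
  · rintro ⟨a, ha⟩ hi
    obtain ⟨b, hb⟩ : 2 ∣ ∏ i ∈ T, p i := h2 ▸ Finset.dvd_prod_of_mem p hi
    rw [ha, hb] at hmT
    have : m = 4 * (a * b) := by rw [← hmT]; ring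
    omega
  · intro hi
    have hodd := h2 ▸ coprime_prod_of_notMem hp hinj hi
    have : 2 ∣ m / (∏ i ∈ T, p i) * ∏ i ∈ T, p i := by rw [hmT]; omega
    exact even_iff_two_dvd.2 (hodd.dvd_of_dvd_mul_right this)

/-- The sum factors as minus a product of terms 1 ± 1. Every index other than i₀ contributes a zero
factor; i₀ alone gives -2. -/
theorem sum_sign_of_two (i₀ : Fin t) :
    ∑ T ∈ (Finset.univ : Finset (Fin t)).powerset, (-1 : ℤ) ^ T.card *
      (if i₀ ∉ T then -1 else 1) = if t = 1 then -2 else 0 := by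
  have hterm : ∀ T : Finset (Fin t), (-1 : ℤ) ^ T.card * (if i₀ ∉ T then -1 else 1)
      = -∏ i ∈ T, if i = i₀ then 1 else -1 := by
    intro T
    have : ∀ i, (if i = i₀ then (1 : ℤ) else -1) = -1 * (if i = i₀ then -1 else 1) := by
      intro i; split_ifs <;> norm_num
    simp_rw [this]
    rw [Finset.prod_mul_distrib, Finset.prod_const, Finset.prod_ite_eq']
    split_ifs <;> simp_all
  simp_rw [hterm]
  rw [Finset.sum_neg_distrib, ← Finset.prod_one_add]
  split_ifs with ht
  · subst ht
    simp [Subsingleton.elim _ i₀]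
  · have : Nontrivial (Fin t) := Fin.nontrivial_iff_two_le.2 (by have := i₀.pos; omega)
    obtain ⟨j, hj⟩ := exists_ne i₀
    rw [Finset.prod_eq_zero (Finset.mem_univ j) (by simp [hj]), neg_zero]

/-- Unless m ≡ 2 mod 4, all quotients have the same parity: all odd if m is odd, all even if 4 ∣ m,
since a squarefree divisor removes at most one factor 2. The alternating sum then vanishes. -/
theorem sum_sign (ht : 1 ≤ t) (hp : ∀ i, (p i).Prime) (hinj : Function.Injective p)
    (hn : ∀ i, 0 < n i) (hm : m = 3 ^ n₀ * ∏ i, p i ^ n i) :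
    ∑ T ∈ (Finset.univ : Finset (Fin t)).powerset, (-1 : ℤ) ^ T.card *
      (if Even (m / ∏ i ∈ T, p i) then -1 else 1)
        = if t = 1 ∧ m ≡ 2 [MOD 4] then -2 else 0 := by
  have hdvd := prod_dvd_of_eq hn hm
  have hne : (Finset.univ : Finset (Fin t)).Nonempty := ⟨⟨0, ht⟩, Finset.mem_univ _⟩
  have hconst : ∀ c : ℤ, ∑ T ∈ (Finset.univ : Finset (Fin t)).powerset, (-1 : ℤ) ^ T.card * c
      = 0 := fun c => by
    rw [← Finset.sum_mul, Finset.sum_powerset_neg_one_pow_card_of_nonempty hne, zero_mul]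
  by_cases hm4 : m ≡ 2 [MOD 4]
  · have hm4' : m % 4 = 2 := hm4
    obtain ⟨i₀, hi₀⟩ : ∃ i, p i = 2 := by
      have h2 : 2 ∣ 3 ^ n₀ * ∏ i, p i ^ n i := by rw [← hm]; omega
      rcases Nat.prime_two.dvd_mul.1 h2 with h | h
      · exact absurd (Nat.prime_two.dvd_of_dvd_pow h) (by norm_num)
      · obtain ⟨i, -, hi⟩ := (Nat.prime_two.prime.dvd_finsetProd_iff _).1 h
        exact ⟨i, ((Nat.prime_dvd_prime_iff_eq Nat.prime_two (hp i)).1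
          (Nat.prime_two.dvd_of_dvd_pow hi)).symm⟩
    simp_rw [even_div_iff hp hinj hi₀ hm4 (hdvd _), sum_sign_of_two, hm4, and_true]
  rw [if_neg fun h => hm4 h.2]
  by_cases hev : Even m
  · have h4 : 4 ∣ m := by
      have : ¬ m % 4 = 2 := hm4
      obtain ⟨a, rfl⟩ := hev
      omega
    rw [← hconst (-1)]
    refine Finset.sum_congr rfl fun T _ => ?_
    rw [if_pos]
    by_contra hodd
    have hcop : Nat.Coprime (2 ^ 2) (m / ∏ i ∈ T, p i) :=
      (Nat.coprime_two_left.2 (Nat.not_even_iff_odd.1 hodd)).pow_left 2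
    have h4' : 2 * 2 ∣ ∏ i ∈ T, p i :=
      hcop.dvd_of_dvd_mul_left (by rw [Nat.div_mul_cancel (hdvd T)]; exact h4)
    have hsq : Squarefree (∏ i ∈ T, p i) :=
      Finset.squarefree_prod_of_pairwise_isCoprime
        (fun i _ j _ hij => Nat.coprime_iff_isRelPrime.1
          ((Nat.coprime_primes (hp i) (hp j)).2 (hinj.ne hij)))
        fun i _ => (hp i).prime.squarefree
    exact absurd (hsq 2 h4') (by decide)
  · rw [← hconst 1]
    refine Finset.sum_congr rfl fun T _ => ?_
    rw [if_neg fun h => hev (h.trans_dvd (Nat.div_dvd_of_dvd (hdvd T)))]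

theorem charP_two_of_card {F : Type*} [Field F] {m : ℕ} (hF : Nat.card F = 2 ^ m) : CharP F 2 := by
  have : Finite F := Nat.finite_of_card_ne_zero (by rw [hF]; positivity)
  have := Fintype.ofFinite F
  rw [Nat.card_eq_fintype_card] at hF
  have : Fact (Nat.Prime 2) := ⟨Nat.prime_two⟩
  exact charP_of_card_eq_prime_pow hF

end Main

theorem mainTheorem8 {F : Type*} [Field F] (k m : ℕ) (hk : 0 < k) (hkm : Nat.Coprime k m)
    (hF : Nat.card F = 2 ^ m)
    (n₀ t : ℕ) (p n : Fin t → ℕ)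
    (hp : ∀ i, (p i).Prime) (hp3 : ∀ i, p i ≠ 3) (hp_inj : Function.Injective p)
    (hn : ∀ i, 0 < n i)
    (hm : m = 3 ^ n₀ * ∏ i, p i ^ n i) :
    (t = 0 → (N k m F : ℚ) = ((2 : ℚ) ^ m + 1) / 3) ∧
    (1 ≤ t → (N k m F : ℚ) =
      (1 / 3 : ℚ) * ((∑ l ∈ Finset.range (t + 1), (-1 : ℚ) ^ l *
        ∑ S ∈ (Finset.univ : Finset (Fin t)).powersetCard l, (2 : ℚ) ^ (m / ∏ i ∈ S, p i))
        - epsilonCorr t m)) := by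
  have := charP_two_of_card hF
  have hm0 : 0 < m := by
    rw [hm]
    exact Nat.mul_pos (by positivity) (Finset.prod_pos fun i _ => Nat.pow_pos (hp i).pos)
  have key := three_mul_N hkm hF hm0 hp hp3 hp_inj hn hm
  constructor
  · rintro rfl
    -- With t = 0, m is a power of 3 and only the empty subset contributes, with sign term +1.
    have hodd : ¬ Even m := by
      rw [hm, Nat.not_even_iff_odd]
      simpa using Odd.pow (by decide : Odd 3)
    simp only [Finset.univ_eq_empty, Finset.powerset_empty, Finset.sum_singleton,
      Finset.card_empty, pow_zero, one_mul, Finset.prod_empty, Nat.div_one, if_neg hodd] at key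
    have hQ : 3 * (N k m F : ℚ) = 2 ^ m + 1 := by exact_mod_cast key
    linarith
  · intro ht
    rw [sum_sign ht hp hp_inj hn hm, Finset.sum_powerset, Finset.card_univ, Fintype.card_fin]
      at key
    have hsum : ∀ l ∈ Finset.range (t + 1),
        ∑ T ∈ (Finset.univ : Finset (Fin t)).powersetCard l, (-1 : ℤ) ^ T.card *
          2 ^ (m / ∏ i ∈ T, p i) = (-1) ^ l *
        ∑ T ∈ (Finset.univ : Finset (Fin t)).powersetCard l, 2 ^ (m / ∏ i ∈ T, p i) := by
      intro l _
      rw [Finset.mul_sum]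
      exact Finset.sum_congr rfl fun T hT => by rw [(Finset.mem_powersetCard.1 hT).2]
    rw [Finset.sum_congr rfl hsum] at key
    have hQ := congrArg (Int.cast : ℤ → ℚ) key
    push_cast at hQ
    rw [epsilonCorr]
    split_ifs at hQ ⊢ <;> linarith
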